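/- Consider $N$ masses $m_j>0$, $j\in[N]$, with spring constants $\kappa_{jk}=\kappa_{kj}\ge 0$ ($\kappa_{jj}$ connects mass $j$ to a wall), whose displacements $x(t)\in\mathbb R^N$, $t\ge 0$, satisfy Newton's equation $m_j\ddot x_j=\sum_{k\ne j}\kappa_{jk}(x_k-x_j)-\kappa_{jj}x_j$, with total energy $E>0$. Index the springs by the pairs $(j,k)$, $j\le k$. For a set $V$ of springs let $$U_V(t)=\tfrac12\sum_{(j,j)\in V}\kappa_{jj}x_j(t)^2+\tfrac12\sum_{j<k,\ (j,k)\in V}\kappa_{jk}(x_j(t)-x_k(t))^2,$$ $$|\psi(t)\rangle=\frac{1}{\sqrt{2E}}\Big(\sum_j\sqrt{m_j}\,\dot x_j(t)|j\rangle+i\sum_j\sqrt{\kappa_{jj}}\,x_j(t)|j,j\rangle+i\sum_{j<k}\sqrt{\kappa_{jk}}\,(x_j(t)-x_k(t))|j,k\rangle\Big),$$ where the $|j\rangle$ and $|j,k\rangle$ are distinct computational basis states of a finite quantum register. Let $\mathcal V$ be a reflection oracle for $V$: a self-adjoint unitary on the register with $\mathcal V|j,k\rangle=-|j,k\rangle$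 if $(j,k)\in V$, $\mathcal V|j,k\rangle=|j,k\rangle$ if $(j,k)\notin V$, and $\mathcal V|j\rangle=|j\rangle$. Let $\mathcal U$ be a unitary circuit that prepares $|\psi(t)\rangle$ from a fixed basis state $|0\rangle$ of the register; it suffices that $\|\mathcal U|0\rangle-|\psi(t)\rangle\|\le\varepsilon/4$. Theorem. There is an absolute constant $C$ such that for every $N$, every such register with its labelling of basis states, every $\varepsilon>0$ and every $0<\delta<1$ there is a quantum query algorithm, which starts in $|0\rangle$ together with ancilla qubits in state $0$, makes in total at most $C\log(2/\delta)/\varepsilon$ uses of $\mathcal V$, $\mathcal U$, $\mathcal U^{-1}$ and their controlled versions (that is, $O(\log(1/\delta)/\varepsilon)$), and ends with a measurement from whose outcome it computes a real number $\hat u$, such that for all masses and spring constants, all solutions $x$ with $E>0$, all $t\ge0$, all $V$, $\mathcal V$ and $\mathcal U$ as above, with probability at least $1-\delta$, $$|\hat u-U_V(t)/E|\le\varepsilon.$$ The algorithm depends only on $N$, the register with its labelling and the state $|0\rangle$, $\varepsilon$ and $\delta$; it accesses $\mathcal V$ and $\mathcal U$ only through these uses. -/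

import Mathlib

open scoped Matrix

noncomputable section

/-! ### Coupled classical oscillators -/

/-- `N` positive masses coupled by springs: `κ j k = κ k j ≥ 0` couples masses `j ≠ k`, and
`κ j j ≥ 0` connects mass `j` to a wall. -/
structure OscillatorSystem (N : ℕ) where
  mass : Fin N → ℝ
  mass_pos : ∀ j, 0 < mass j
  κ : Fin N → Fin N → ℝ
  κ_symm : ∀ j k, κ j k = κ k j
  κ_nonneg : ∀ j k, 0 ≤ κ j k

/-- Spring labels `(j, k)` with `j ≤ k`; there are `N (N + 1) / 2` of them. -/
abbrev Spring (N : ℕ) : Type := {p : Fin N × Fin N // p.1 ≤ p.2}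

/-- Labels of the basis states `|j⟩` (oscillators) and `|j, k⟩` (springs) of `ℂ ^ (N + M)`,
`M = N (N + 1) / 2`. -/
abbrev BasisLabel (N : ℕ) : Type := Fin N ⊕ Spring N

namespace OscillatorSystem

variable {N : ℕ} (S : OscillatorSystem N)

/-- The force on mass `j` when the displacements are `x`. -/
def force (x : Fin N → ℝ) (j : Fin N) : ℝ :=
  ∑ k ∈ Finset.univ.erase j, S.κ j k * (x k - x j) - S.κ j j * x j

/-- On `[0, ∞)`, `v` is the velocity of `x` and Newton's equation
`m_j x_j'' = ∑_{k ≠ j} κ_jk (x_k - x_j) - κ_jj x_j` holds (one-sided derivatives at `0`). -/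
def IsTrajectory (x v : ℝ → Fin N → ℝ) : Prop :=
  ∀ t : ℝ, 0 ≤ t → ∀ j : Fin N,
    HasDerivWithinAt (fun s => x s j) (v t j) (Set.Ici 0) t ∧
    HasDerivWithinAt (fun s => S.mass j * v s j) (S.force (x t) j) (Set.Ici 0) t

/-- Elongation of the spring `(j, k)`: `x_j` if `j = k`, and `x_j - x_k` if `j < k`. -/
def elongation (x : Fin N → ℝ) (s : Spring N) : ℝ :=
  if s.1.1 = s.1.2 then x s.1.1 else x s.1.1 - x s.1.2

/-- Kinetic energy. -/
def kineticEnergy (v : Fin N → ℝ) : ℝ :=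
  (1 / 2) * ∑ j, S.mass j * v j ^ 2

/-- Potential energy stored in the springs of the set `V`. -/
def potentialEnergyOn (V : Finset (Spring N)) (x : Fin N → ℝ) : ℝ :=
  (1 / 2) * ∑ s ∈ V, S.κ s.1.1 s.1.2 * elongation x s ^ 2

/-- Total energy: the kinetic energy plus the potential energy of all springs. -/
def totalEnergy (x v : Fin N → ℝ) : ℝ :=
  S.kineticEnergy v + S.potentialEnergyOn Finset.univ x

/-- The vector `(2E)^{-1/2} (√M v, i μ)`, with `μ_s = √κ_s · (elongation of s)`. -/
def encodedState (E : ℝ) (x v : Fin N → ℝ) : BasisLabel N → ℂ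
  | Sum.inl j => ((Real.sqrt (S.mass j) * v j / Real.sqrt (2 * E) : ℝ) : ℂ)
  | Sum.inr s => Complex.I *
      ((Real.sqrt (S.κ s.1.1 s.1.2) * elongation x s / Real.sqrt (2 * E) : ℝ) : ℂ)

end OscillatorSystem

/-! ### Registers, preparation circuits and reflection oracles

A quantum register has a finite set `Reg` of computational basis labels and state space
`Reg → ℂ`. The basis states `|j⟩`, `|j, k⟩` are stored in it through an injection `enc` into the
basis labels of the register, which may also hold the workspace of the circuits. -/

section Registers

variable {N : ℕ} {Reg : Type} [Fintype Reg] [DecidableEq Reg]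

/-- The computational basis state with label `r`. -/
def ket {ι : Type} [DecidableEq ι] (r : ι) : ι → ℂ := Pi.single r 1

/-- A vector of `ℂ ^ (N + M)` as a vector of the register. -/
def embedState (enc : BasisLabel N ↪ Reg) (ψ : BasisLabel N → ℂ) : Reg → ℂ :=
  ∑ b, ψ b • ket (enc b)

/-- The circuit `U` is unitary and maps the basis state `r₀` to a state at Euclidean distance at
most `η` from `ψ`. -/
def PreparesWithin (U : Matrix Reg Reg ℂ) (r₀ : Reg) (ψ : Reg → ℂ) (η : ℝ) : Prop :=
  U ∈ Matrix.unitaryGroup Reg ℂ ∧ ‖WithLp.toLp 2 (U *ᵥ ket r₀ - ψ)‖ ≤ η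

/-- `R` is a reflection (a self-adjoint unitary) with `R|j,k⟩ = -|j,k⟩` for `(j,k) ∈ V`,
`R|j,k⟩ = |j,k⟩` for `(j,k) ∉ V`, and `R|j⟩ = |j⟩`. Nothing more is asked of `R` on the basis
states of the register that encode no label. -/
structure IsReflectionOracle (enc : BasisLabel N ↪ Reg) (V : Finset (Spring N))
    (R : Matrix Reg Reg ℂ) : Prop where
  unitary : R ∈ Matrix.unitaryGroup Reg ℂ
  hermitian : R.IsHermitian
  spring_mem : ∀ s ∈ V, R *ᵥ ket (enc (Sum.inr s)) = -ket (enc (Sum.inr s))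
  spring_notMem : ∀ s ∉ V, R *ᵥ ket (enc (Sum.inr s)) = ket (enc (Sum.inr s))
  oscillator : ∀ j, R *ᵥ ket (enc (Sum.inl j)) = ket (enc (Sum.inl j))

end Registers

/-! ### Quantum query algorithms -/

/-- The black boxes: the reflection, the preparation circuit, and the inverse of the latter. -/
inductive OracleCall
  | reflect
  | prepare
  | prepareInv

/-- One step of a quantum query algorithm on the register and `a` ancilla qubits: a fixed unitary
gate, or one use of a black box on the register, either plain (`none`) or controlled by an ancilla
qubit (`some i`). -/
inductive QStep (a : ℕ) (Reg : Type) [Fintype Reg] [DecidableEq Reg]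
  | gate (G : Matrix.unitaryGroup (Reg × (Fin a → Bool)) ℂ)
  | call (control : Option (Fin a)) (q : OracleCall)

/-- A quantum query algorithm with real output: the number of ancilla qubits, the sequence of
steps, and the output computed from the outcome of a final measurement of the register and the
ancillas in the computational basis. It does not refer to the black boxes it is run with. -/
structure QueryAlgorithm (Reg : Type) [Fintype Reg] [DecidableEq Reg] where
  ancillas : ℕ
  steps : List (QStep ancillas Reg)
  output : Reg × (Fin ancillas → Bool) → ℝ

section Semantics

variable {Reg : Type} [Fintype Reg] [DecidableEq Reg]

/-- The matrix of a black box, given the reflection `R` and the preparation circuit `U`. -/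
def OracleCall.matrix (R U : Matrix Reg Reg ℂ) : OracleCall → Matrix Reg Reg ℂ
  | .reflect => R
  | .prepare => U
  | .prepareInv => Uᴴ

/-- The (controlled) operator `A`: it applies `A` to the register on the ancilla basis states whose
control qubit is `1`, and the identity on the others; without control it always applies `A`. -/
def controlledMatrix {a : ℕ} (control : Option (Fin a)) (A : Matrix Reg Reg ℂ) :
    Matrix (Reg × (Fin a → Bool)) (Reg × (Fin a → Bool)) ℂ :=
  Matrix.blockDiagonal fun b : Fin a → Bool =>
    match control with
    | none => A
    | some i => if b i = true then A else 1

/-- The matrix of a step, given the black boxes. -/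
def QStep.matrix {a : ℕ} (R U : Matrix Reg Reg ℂ) :
    QStep a Reg → Matrix (Reg × (Fin a → Bool)) (Reg × (Fin a → Bool)) ℂ
  | .gate G => (G : Matrix (Reg × (Fin a → Bool)) (Reg × (Fin a → Bool)) ℂ)
  | .call control q => controlledMatrix control (q.matrix R U)

/-- The number of uses of black boxes in a step. -/
def QStep.uses {a : ℕ} : QStep a Reg → ℕ
  | .gate _ => 0
  | .call _ _ => 1

namespace QueryAlgorithm

variable (𝒜 : QueryAlgorithm Reg)

/-- The total number of (plain or controlled) uses of the black boxes. -/
def uses : ℕ := (𝒜.steps.map QStep.uses).sum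

/-- The state before the measurement: the steps are applied in order to `r₀` and ancillas `0`. -/
def finalState (R U : Matrix Reg Reg ℂ) (r₀ : Reg) : Reg × (Fin 𝒜.ancillas → Bool) → ℂ :=
  𝒜.steps.foldl (fun ψ s => s.matrix R U *ᵥ ψ) (ket (r₀, fun _ => false))

open Classical in
/-- The probability that the output lies in `s`. -/
def outputProb (R U : Matrix Reg Reg ℂ) (r₀ : Reg) (s : Set ℝ) : ℝ :=
  ∑ p, if 𝒜.output p ∈ s then ‖𝒜.finalState R U r₀ p‖ ^ 2 else 0

end QueryAlgorithm

end Semantics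

end

/-! The springs in `V` carry the weight `U_V/E` in the encoded state, and a reflection oracle flips
the sign of exactly these components. So the oracle `R` has expectation `1 - 2 U_V/E` in that state,
and energy conservation makes the state a unit vector at every time `t ≥ 0`. It remains to estimate
`⟨φ|R|φ⟩` for the prepared state `φ = U|r₀⟩`; replacing the ideal state by `φ` moves the expectation
by at most twice their distance.

Let `G = (2|φ⟩⟨φ| - 1) R`. Since `G²φ = 2⟨φ|R|φ⟩ Gφ - φ`, the vector `φ` is a sum of two orthogonal
eigenvectors of `G` with eigenvalues `e^{±iθ}`, `cos θ = ⟨φ|R|φ⟩`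
(`exists_eigenvector_decomposition`). Both eigenvalues have the same real part, so it does not
matter which one phase estimation sees. One use of `G` costs three black boxes, because `2|φ⟩⟨φ| -
1` is the reflection about `r₀` conjugated by `U`.

A single run of phase estimation reaches confidence `1 - δ`, without a median of repetitions,
because the counter starts in a smooth superposition: its amplitudes are the normalized coefficients
of the power `L + 1` of a Dirichlet kernel of length `K`. The Fourier transform then samples this
polynomial on the unit circle. At distance `η ≥ 4/K` from the phase each factor is at most `1/2`, so
the tail decays like `4^{-L}` (`sum_phaseProb_le`). With `K` of order `1/ε` and `L` of order `log
(2/δ)`, a counter of size about `K (L + 1)` suffices, and its size bounds the number of queries. -/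

noncomputable section

/-! ### Energy conservation and the weights of the encoded state. -/

namespace OscillatorSystem

variable {N : ℕ} (S : OscillatorSystem N)

/-- Power balance: the forces do the work that the springs lose. -/
theorem sum_spring_eq_neg_sum_force (x v : Fin N → ℝ) :
    ∑ s : Spring N, S.κ s.1.1 s.1.2 * (elongation x s * elongation v s) =
      -∑ j, v j * S.force x j := by
  have h1 : ∑ s : Spring N, S.κ s.1.1 s.1.2 * (elongation x s * elongation v s) =
      ∑ p : Fin N × Fin N, if p.1 ≤ p.2 then
        S.κ p.1 p.2 * (if p.1 = p.2 then x p.1 * v p.1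
          else (x p.1 - x p.2) * (v p.1 - v p.2)) else 0 := by
    rw [← Finset.sum_filter, Finset.sum_subtype (p := fun p : Fin N × Fin N => p.1 ≤ p.2) _
      (by simp)]
    refine Finset.sum_congr rfl fun s _ => ?_
    unfold elongation
    split_ifs <;> simp
  have h2 : ∀ j, v j * S.force x j =
      ∑ k, (S.κ j k * v j * (x k - x j) - if j = k then S.κ j j * x j * v j else 0) := by
    intro j
    rw [Finset.sum_sub_distrib, force, Finset.sum_erase _ (by simp), Finset.sum_ite_eq]
    simp only [Finset.mem_univ, if_true, mul_sub, Finset.mul_sum]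
    congr 1
    · exact Finset.sum_congr rfl fun k _ => by ring
    · ring
  -- The work of the forces runs over ordered pairs, the springs over pairs `j < k`. For `j < k`, `f
  -- j k + g k j` is the full term `κ (x_j - x_k) (v_j - v_k)`, so transposing the `g` part matches
  -- the two sums.
  set f : Fin N → Fin N → ℝ := fun j k => if j < k then S.κ j k * v j * (x j - x k) else 0
  set g : Fin N → Fin N → ℝ := fun j k => if k < j then S.κ j k * v j * (x j - x k) else 0
  have hswap : ∑ j, ∑ k, g j k = ∑ j, ∑ k, g k j := Finset.sum_comm
  have h3 : ∑ j, ∑ k, (f j k + g j k + if j = k then S.κ j j * x j * v j else 0) =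
      ∑ j, ∑ k, (f j k + g k j + if j = k then S.κ j j * x j * v j else 0) := by
    simp only [Finset.sum_add_distrib]
    rw [hswap]
  rw [h1, Fintype.sum_prod_type, ← Finset.sum_neg_distrib]
  calc _ = ∑ j, ∑ k, (f j k + g k j + if j = k then S.κ j j * x j * v j else 0) := by
        refine Finset.sum_congr rfl fun j _ => Finset.sum_congr rfl fun k _ => ?_
        simp only [f, g]
        rcases lt_trichotomy j k with h | rfl | h
        · simp only [h, h.le, h.ne, if_true, if_false, S.κ_symm k j]; ring
        · simp; ring
        · simp [h.not_ge, h.not_gt, h.ne']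
    _ = _ := by
        rw [← h3]
        refine Finset.sum_congr rfl fun j _ => ?_
        rw [h2, ← Finset.sum_neg_distrib]
        refine Finset.sum_congr rfl fun k _ => ?_
        simp only [f, g]
        rcases lt_trichotomy j k with h | rfl | h
        · simp only [h, h.not_gt, h.ne, if_true, if_false]; ring
        · simp
        · simp only [h, h.not_gt, h.ne', if_true, if_false]; ring

variable {S} {x v : ℝ → Fin N → ℝ}

theorem IsTrajectory.hasDerivWithinAt_totalEnergy (h : S.IsTrajectory x v) {t : ℝ} (ht : 0 ≤ t) :
    HasDerivWithinAt (fun s => S.totalEnergy (x s) (v s)) 0 (Set.Ici 0) t := by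
  have hv : ∀ j, HasDerivWithinAt (fun s => S.mass j * v s j ^ 2)
      (2 * (v t j * S.force (x t) j)) (Set.Ici 0) t := by
    intro j
    have hm := (S.mass_pos j).ne'
    -- Newton's law is stated for the momentum `m v`, so `m v²` is differentiated as `m⁻¹ (m v)²`.
    have h1 := ((h t ht j).2.fun_pow 2).const_mul (S.mass j)⁻¹
    refine (h1.congr_deriv ?_).congr_of_mem (fun s _ => ?_) ht
    · push_cast
      field_simp
    · field_simp
  have he : ∀ s : Spring N, HasDerivWithinAt (fun τ => S.κ s.1.1 s.1.2 * elongation (x τ) s ^ 2)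
      (2 * (S.κ s.1.1 s.1.2 * (elongation (x t) s * elongation (v t) s))) (Set.Ici 0) t := by
    intro s
    have h1 : HasDerivWithinAt (fun τ => elongation (x τ) s) (elongation (v t) s)
        (Set.Ici 0) t := by
      unfold elongation
      split_ifs
      · exact (h t ht _).1
      · exact (h t ht _).1.fun_sub (h t ht _).1
    refine ((h1.fun_pow 2).const_mul _).congr_deriv ?_
    push_cast
    ring
  have h1 := (HasDerivWithinAt.fun_sum fun j (_ : j ∈ Finset.univ) => hv j).const_mul (1 / 2)
  have h2 := (HasDerivWithinAt.fun_sum fun s (_ : s ∈ Finset.univ) => he s).const_mul (1 / 2)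
  refine (h1.fun_add h2).congr_deriv ?_
  rw [← Finset.mul_sum, ← Finset.mul_sum, S.sum_spring_eq_neg_sum_force]
  ring

/-- Conservation of energy. -/
theorem IsTrajectory.totalEnergy_eq (h : S.IsTrajectory x v) {t : ℝ} (ht : 0 ≤ t) :
    S.totalEnergy (x t) (v t) = S.totalEnergy (x 0) (v 0) := by
  refine constant_of_has_deriv_right_zero
    (f := fun s => S.totalEnergy (x s) (v s)) (a := 0) (b := t) (fun s hs => ?_) (fun s hs => ?_)
    t ⟨ht, le_rfl⟩
  · exact (h.hasDerivWithinAt_totalEnergy hs.1).continuousWithinAt.mono Set.Icc_subset_Ici_self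
  · exact (h.hasDerivWithinAt_totalEnergy hs.1).mono (Set.Ici_subset_Ici.2 hs.1)

theorem norm_sq_encodedState_inl {E : ℝ} (hE : 0 < E) (x v : Fin N → ℝ) (j : Fin N) :
    ‖S.encodedState E x v (Sum.inl j)‖ ^ 2 = S.mass j * v j ^ 2 / (2 * E) := by
  rw [encodedState, Complex.norm_real, Real.norm_eq_abs, sq_abs, div_pow, mul_pow,
    Real.sq_sqrt (S.mass_pos j).le, Real.sq_sqrt (by positivity)]

theorem norm_sq_encodedState_inr {E : ℝ} (hE : 0 < E) (x v : Fin N → ℝ) (s : Spring N) :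
    ‖S.encodedState E x v (Sum.inr s)‖ ^ 2 =
      S.κ s.1.1 s.1.2 * elongation x s ^ 2 / (2 * E) := by
  rw [encodedState, norm_mul, Complex.norm_I, one_mul, Complex.norm_real, Real.norm_eq_abs,
    sq_abs, div_pow, mul_pow, Real.sq_sqrt (S.κ_nonneg _ _), Real.sq_sqrt (by positivity)]

theorem sum_norm_sq_encodedState_inr {E : ℝ} (hE : 0 < E) (x v : Fin N → ℝ)
    (V : Finset (Spring N)) :
    ∑ s ∈ V, ‖S.encodedState E x v (Sum.inr s)‖ ^ 2 = S.potentialEnergyOn V x / E := by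
  simp only [norm_sq_encodedState_inr hE, ← Finset.sum_div, potentialEnergyOn]
  field_simp

theorem sum_norm_sq_encodedState {E : ℝ} (hE : 0 < E) {x v : Fin N → ℝ}
    (h : S.totalEnergy x v = E) : ∑ b, ‖S.encodedState E x v b‖ ^ 2 = 1 := by
  rw [Fintype.sum_sum_type, sum_norm_sq_encodedState_inr hE]
  simp only [norm_sq_encodedState_inl hE, ← Finset.sum_div]
  rw [totalEnergy, kineticEnergy] at h
  field_simp
  linarith

theorem potentialEnergyOn_nonneg (V : Finset (Spring N)) (x : Fin N → ℝ) :
    0 ≤ S.potentialEnergyOn V x :=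
  mul_nonneg (by norm_num)
    (Finset.sum_nonneg fun _ _ => mul_nonneg (S.κ_nonneg _ _) (sq_nonneg _))

theorem potentialEnergyOn_le_totalEnergy (V : Finset (Spring N)) (x v : Fin N → ℝ) :
    S.potentialEnergyOn V x ≤ S.totalEnergy x v := by
  have h1 : S.potentialEnergyOn V x ≤ S.potentialEnergyOn Finset.univ x :=
    mul_le_mul_of_nonneg_left (Finset.sum_le_sum_of_subset_of_nonneg (Finset.subset_univ V)
      fun _ _ _ => mul_nonneg (S.κ_nonneg _ _) (sq_nonneg _)) (by norm_num)
  have h2 : 0 ≤ S.kineticEnergy v := mul_nonneg (by norm_num)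
    (Finset.sum_nonneg fun j _ => mul_nonneg (S.mass_pos j).le (sq_nonneg _))
  rw [totalEnergy]
  linarith

end OscillatorSystem

/-! ### Inner products, unitaries and expectation values. -/

section Vectors

open Matrix

variable {ι : Type} [Fintype ι]

theorem star_dotProduct_self_eq (x : ι → ℂ) :
    star x ⬝ᵥ x = ((∑ i, ‖x i‖ ^ 2 : ℝ) : ℂ) := by
  simp only [dotProduct, Pi.star_apply, RCLike.star_def, Complex.conj_mul']
  push_cast
  rfl

theorem star_dotProduct_comm (x y : ι → ℂ) : star y ⬝ᵥ x = star (star x ⬝ᵥ y) := by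
  simp [dotProduct, star_sum, mul_comm]

theorem norm_star_dotProduct_le (x y : ι → ℂ) :
    ‖star x ⬝ᵥ y‖ ≤ ‖WithLp.toLp 2 x‖ * ‖WithLp.toLp 2 y‖ := by
  have h := norm_inner_le_norm (𝕜 := ℂ) (WithLp.toLp 2 x) (WithLp.toLp 2 y)
  rwa [EuclideanSpace.inner_eq_star_dotProduct, dotProduct_comm] at h

theorem norm_toLp_sq (x : ι → ℂ) : ‖WithLp.toLp 2 x‖ ^ 2 = ∑ i, ‖x i‖ ^ 2 :=
  EuclideanSpace.norm_sq_eq _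

theorem norm_toLp_eq_one {x : ι → ℂ} (h : ∑ i, ‖x i‖ ^ 2 = 1) : ‖WithLp.toLp 2 x‖ = 1 := by
  rw [← norm_toLp_sq] at h
  exact (pow_eq_one_iff_of_nonneg (norm_nonneg _) two_ne_zero).1 h

/-- Norms of orthogonal vectors, with coefficients. -/
theorem sum_norm_sq_smul_add_smul {x y : ι → ℂ} (h : star x ⬝ᵥ y = 0) (a b : ℂ) :
    ∑ i, ‖(a • x + b • y) i‖ ^ 2 =
      ‖a‖ ^ 2 * ∑ i, ‖x i‖ ^ 2 + ‖b‖ ^ 2 * ∑ i, ‖y i‖ ^ 2 := by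
  have h' : star y ⬝ᵥ x = 0 := by rw [star_dotProduct_comm, h, star_zero]
  apply Complex.ofReal_injective
  rw [← star_dotProduct_self_eq, Complex.ofReal_add, Complex.ofReal_mul, Complex.ofReal_mul,
    ← star_dotProduct_self_eq, ← star_dotProduct_self_eq]
  simp only [star_add, star_smul, add_dotProduct, dotProduct_add, smul_dotProduct,
    dotProduct_smul, h, h', smul_eq_mul, Complex.ofReal_pow, ← Complex.conj_mul',
    RCLike.star_def]
  ring

/-- The expectation value `⟨φ|R|φ⟩`. -/
def expectation (R : Matrix ι ι ℂ) (φ : ι → ℂ) : ℝ := (star φ ⬝ᵥ R *ᵥ φ).re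

theorem star_dotProduct_mulVec_self {R : Matrix ι ι ℂ} (hR : R.IsHermitian) (φ : ι → ℂ) :
    star φ ⬝ᵥ R *ᵥ φ = (expectation R φ : ℂ) := by
  have h : star (star φ ⬝ᵥ R *ᵥ φ) = star φ ⬝ᵥ R *ᵥ φ := by
    rw [← star_dotProduct_comm, star_mulVec, hR.eq, dotProduct_mulVec]
  exact (Complex.conj_eq_iff_re.1 h).symm

variable [DecidableEq ι]

theorem sum_norm_sq_ket (r : ι) : ∑ i, ‖ket r i‖ ^ 2 = 1 := by
  simp [ket, Pi.single_apply, apply_ite norm]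

theorem star_dotProduct_mulVec {A : Matrix ι ι ℂ} (hA : A ∈ unitaryGroup ι ℂ) (x y : ι → ℂ) :
    star (A *ᵥ x) ⬝ᵥ (A *ᵥ y) = star x ⬝ᵥ y := by
  rw [star_mulVec, ← dotProduct_mulVec, mulVec_mulVec, ← star_eq_conjTranspose,
    mem_unitaryGroup_iff'.1 hA, one_mulVec]

theorem sum_norm_sq_mulVec {A : Matrix ι ι ℂ} (hA : A ∈ unitaryGroup ι ℂ) (x : ι → ℂ) :
    ∑ i, ‖(A *ᵥ x) i‖ ^ 2 = ∑ i, ‖x i‖ ^ 2 := by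
  apply Complex.ofReal_injective
  rw [← star_dotProduct_self_eq, star_dotProduct_mulVec hA, star_dotProduct_self_eq]

theorem norm_toLp_mulVec {A : Matrix ι ι ℂ} (hA : A ∈ unitaryGroup ι ℂ) (x : ι → ℂ) :
    ‖WithLp.toLp 2 (A *ᵥ x)‖ = ‖WithLp.toLp 2 x‖ := by
  rw [← sq_eq_sq₀ (norm_nonneg _) (norm_nonneg _), norm_toLp_sq, norm_toLp_sq,
    sum_norm_sq_mulVec hA]

/-- Expectation values in nearby unit vectors are close. -/
theorem abs_expectation_sub_le {R : Matrix ι ι ℂ} (hR : R ∈ unitaryGroup ι ℂ) {φ ψ : ι → ℂ}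
    (hφ : ∑ i, ‖φ i‖ ^ 2 = 1) (hψ : ∑ i, ‖ψ i‖ ^ 2 = 1) :
    |expectation R φ - expectation R ψ| ≤ 2 * ‖WithLp.toLp 2 (φ - ψ)‖ := by
  have h : star φ ⬝ᵥ R *ᵥ φ - star ψ ⬝ᵥ R *ᵥ ψ =
      star (φ - ψ) ⬝ᵥ R *ᵥ φ + star ψ ⬝ᵥ R *ᵥ (φ - ψ) := by
    rw [mulVec_sub, star_sub, sub_dotProduct, dotProduct_sub]
    ring
  rw [expectation, expectation, ← Complex.sub_re, h]
  refine (Complex.abs_re_le_norm _).trans ((norm_add_le _ _).trans ?_)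
  have h1 := norm_star_dotProduct_le (φ - ψ) (R *ᵥ φ)
  have h2 := norm_star_dotProduct_le ψ (R *ᵥ (φ - ψ))
  rw [norm_toLp_mulVec hR, norm_toLp_eq_one hφ] at h1
  rw [norm_toLp_mulVec hR, norm_toLp_eq_one hψ] at h2
  linarith

theorem abs_expectation_le_one {R : Matrix ι ι ℂ} (hR : R ∈ unitaryGroup ι ℂ) {φ : ι → ℂ}
    (hφ : ∑ i, ‖φ i‖ ^ 2 = 1) : |expectation R φ| ≤ 1 := by
  have h := norm_star_dotProduct_le φ (R *ᵥ φ)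
  rw [norm_toLp_mulVec hR, norm_toLp_eq_one hφ, mul_one] at h
  exact (Complex.abs_re_le_norm _).trans h

end Vectors

/-! ### The expectation of the reflection oracle in an encoded state. -/

section ReflectionExpectation

open Matrix

variable {N : ℕ} {Reg : Type} [DecidableEq Reg] (enc : BasisLabel N ↪ Reg)

theorem embedState_enc (ψ : BasisLabel N → ℂ) (b : BasisLabel N) :
    embedState enc ψ (enc b) = ψ b := by
  simp [embedState, ket, Pi.single_apply, enc.injective.eq_iff]

variable [Fintype Reg]

theorem dotProduct_embedState (f : Reg → ℂ) (ψ : BasisLabel N → ℂ) :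
    f ⬝ᵥ embedState enc ψ = ∑ b, f (enc b) * ψ b := by
  rw [embedState, dotProduct_sum]
  refine Finset.sum_congr rfl fun b _ => ?_
  rw [dotProduct_smul, ket, dotProduct_single, mul_one, smul_eq_mul, mul_comm]

theorem sum_norm_sq_embedState (ψ : BasisLabel N → ℂ) :
    ∑ r, ‖embedState enc ψ r‖ ^ 2 = ∑ b, ‖ψ b‖ ^ 2 := by
  apply Complex.ofReal_injective
  rw [← star_dotProduct_self_eq, ← star_dotProduct_self_eq, dotProduct_embedState]
  simp only [Pi.star_apply, embedState_enc]
  rfl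

variable {enc}

theorem IsReflectionOracle.mulVec_embedState {V : Finset (Spring N)} {R : Matrix Reg Reg ℂ}
    (hR : IsReflectionOracle enc V R) (ψ : BasisLabel N → ℂ) :
    R *ᵥ embedState enc ψ =
      embedState enc (Sum.elim (fun j => ψ (Sum.inl j))
        fun s => if s ∈ V then -ψ (Sum.inr s) else ψ (Sum.inr s)) := by
  rw [embedState, embedState, mulVec_sum]
  refine Finset.sum_congr rfl fun b _ => ?_
  rw [mulVec_smul]
  rcases b with j | s
  · rw [hR.oscillator, Sum.elim_inl]
  · by_cases h : s ∈ V
    · rw [hR.spring_mem s h, Sum.elim_inr, if_pos h, smul_neg, neg_smul]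
    · rw [hR.spring_notMem s h, Sum.elim_inr, if_neg h]

/-- Flipping the sign of the components in `V` subtracts their weight twice. The oracle's action on
labels outside the range of `enc` plays no role, since the embedded state vanishes there. -/
theorem IsReflectionOracle.expectation_embedState {V : Finset (Spring N)} {R : Matrix Reg Reg ℂ}
    (hR : IsReflectionOracle enc V R) (ψ : BasisLabel N → ℂ) :
    expectation R (embedState enc ψ) =
      ∑ b, ‖ψ b‖ ^ 2 - 2 * ∑ s ∈ V, ‖ψ (Sum.inr s)‖ ^ 2 := by
  rw [expectation, hR.mulVec_embedState, dotProduct_embedState, Fintype.sum_sum_type,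
    Fintype.sum_sum_type]
  simp only [Pi.star_apply, embedState_enc, Sum.elim_inl, Sum.elim_inr, RCLike.star_def,
    Complex.conj_mul', Complex.add_re, Complex.re_sum, mul_ite, mul_neg]
  rw [add_sub_assoc, ← Finset.sum_filter_add_sum_filter_not Finset.univ (· ∈ V)
    (fun s => ‖ψ (Sum.inr s)‖ ^ 2), ← Finset.sum_filter_add_sum_filter_not Finset.univ (· ∈ V),
    Finset.filter_univ_mem,
    Finset.sum_congr rfl fun s (hs : s ∈ V) => congrArg Complex.re (if_pos hs),
    Finset.sum_congr rfl fun s hs => congrArg Complex.re (if_neg (Finset.mem_filter.1 hs).2)]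
  simp only [Complex.neg_re, ← Complex.ofReal_pow, Complex.ofReal_re, Finset.sum_neg_distrib]
  ring

end ReflectionExpectation

/-! ### Spectral analysis of the Grover iterate. -/

section Grover

open Matrix

variable {ι : Type} [Fintype ι] [DecidableEq ι]

/-- The reflection `2 |x⟩⟨x| - 1`. -/
def reflectionAbout (x : ι → ℂ) : Matrix ι ι ℂ := (2 : ℂ) • vecMulVec x (star x) - 1

theorem reflectionAbout_mulVec (x y : ι → ℂ) :
    reflectionAbout x *ᵥ y = (2 * (star x ⬝ᵥ y)) • x - y := by
  rw [reflectionAbout, sub_mulVec, smul_mulVec, vecMulVec_mulVec, one_mulVec, op_smul_eq_smul,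
    smul_smul]

theorem reflectionAbout_mem_unitaryGroup {x : ι → ℂ} (hx : ∑ i, ‖x i‖ ^ 2 = 1) :
    reflectionAbout x ∈ unitaryGroup ι ℂ := by
  have hs : star (reflectionAbout x) = reflectionAbout x := by
    rw [reflectionAbout, star_sub, star_smul, star_one, star_eq_conjTranspose,
      conjTranspose_vecMulVec, star_star]
    simp
  have h1 : star x ⬝ᵥ x = 1 := by rw [star_dotProduct_self_eq, hx, Complex.ofReal_one]
  rw [mem_unitaryGroup_iff, hs]
  refine Matrix.ext_of_mulVec_single fun i => ?_
  rw [← mulVec_mulVec, reflectionAbout_mulVec, reflectionAbout_mulVec, one_mulVec, dotProduct_sub,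
    dotProduct_smul, h1, smul_eq_mul]
  module

theorem mul_reflectionAbout_mul_conjTranspose (U : Matrix ι ι ℂ)
    (hU : U ∈ unitaryGroup ι ℂ) (x : ι → ℂ) :
    U * reflectionAbout x * Uᴴ = reflectionAbout (U *ᵥ x) := by
  rw [reflectionAbout, reflectionAbout, mul_sub, sub_mul, mul_one, ← star_eq_conjTranspose,
    mem_unitaryGroup_iff.1 hU, Matrix.mul_smul, Matrix.smul_mul, mul_vecMulVec, vecMulVec_mul,
    star_mulVec, star_eq_conjTranspose]

/-- The Grover iterate of the reflections about `φ` and `R`. -/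
def groverIterate (R : Matrix ι ι ℂ) (φ : ι → ℂ) : Matrix ι ι ℂ := reflectionAbout φ * R

theorem groverIterate_mem_unitaryGroup {R : Matrix ι ι ℂ} (hR : R ∈ unitaryGroup ι ℂ)
    {φ : ι → ℂ} (hφ : ∑ i, ‖φ i‖ ^ 2 = 1) : groverIterate R φ ∈ unitaryGroup ι ℂ :=
  mul_mem (reflectionAbout_mem_unitaryGroup hφ) hR

theorem groverIterate_mulVec_self {R : Matrix ι ι ℂ} (hR : R.IsHermitian) (φ : ι → ℂ) :
    groverIterate R φ *ᵥ φ = (2 * (expectation R φ : ℂ)) • φ - R *ᵥ φ := by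
  rw [groverIterate, ← mulVec_mulVec, reflectionAbout_mulVec, star_dotProduct_mulVec_self hR]

/-- The Cayley–Hamilton relation of a plane rotation with trace `2 cos θ` and determinant `1`,
evaluated at `φ`. It follows from `G R φ = φ`, which holds because `R² = 1` and the reflection about
`φ` fixes `φ`. -/
theorem groverIterate_mulVec_mulVec {R : Matrix ι ι ℂ} (hR : R.IsHermitian)
    (hR' : R ∈ unitaryGroup ι ℂ) {φ : ι → ℂ} (hφ : ∑ i, ‖φ i‖ ^ 2 = 1) :
    groverIterate R φ *ᵥ (groverIterate R φ *ᵥ φ) =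
      (2 * (expectation R φ : ℂ)) • (groverIterate R φ *ᵥ φ) - φ := by
  have h : groverIterate R φ *ᵥ (R *ᵥ φ) = φ := by
    have hRR : R * R = 1 := by
      have := mem_unitaryGroup_iff.1 hR'
      rwa [star_eq_conjTranspose, hR.eq] at this
    rw [groverIterate, mulVec_mulVec, mul_assoc, hRR, mul_one, reflectionAbout_mulVec,
      star_dotProduct_self_eq, hφ, Complex.ofReal_one]
    module
  conv_lhs => rw [groverIterate_mulVec_self hR, mulVec_sub, mulVec_smul, h]

open scoped ComplexOrder in
/-- If `⟨φ|R|φ⟩ = ±1`, then `φ` is an eigenvector of `R`. -/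
theorem mulVec_eq_of_expectation_sq {R : Matrix ι ι ℂ} (hR : R.IsHermitian)
    (hR' : R ∈ unitaryGroup ι ℂ) {φ : ι → ℂ} (hφ : ∑ i, ‖φ i‖ ^ 2 = 1)
    (h : expectation R φ ^ 2 = 1) : R *ᵥ φ = (expectation R φ : ℂ) • φ := by
  rw [← sub_eq_zero, ← dotProduct_star_self_eq_zero]
  have h1 : star φ ⬝ᵥ φ = 1 := by rw [star_dotProduct_self_eq, hφ, Complex.ofReal_one]
  have h2 : star (R *ᵥ φ) ⬝ᵥ φ = expectation R φ := by
    rw [star_dotProduct_comm, star_dotProduct_mulVec_self hR, RCLike.star_def, Complex.conj_ofReal]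
  rw [star_sub, star_smul, sub_dotProduct, dotProduct_sub, dotProduct_sub, smul_dotProduct,
    dotProduct_smul, dotProduct_smul, smul_dotProduct, star_dotProduct_mulVec hR', h1, h2,
    star_dotProduct_mulVec_self hR, RCLike.star_def, Complex.conj_ofReal]
  simp only [smul_eq_mul]
  have h' : (expectation R φ : ℂ) ^ 2 = 1 := by exact_mod_cast h
  linear_combination -h'

/-- Unitarity gives `⟨e,f⟩ = ⟨Ge,Gf⟩ = z̄² ⟨e,f⟩`, and `z̄² ≠ 1` because `z z̄ = 1` and `z ≠ z̄`. -/
theorem star_dotProduct_eq_zero_of_eigenvectors {G : Matrix ι ι ℂ} (hG : G ∈ unitaryGroup ι ℂ)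
    {z : ℂ} (hz : z * star z = 1) (hne : z - star z ≠ 0) {e f : ι → ℂ}
    (he : G *ᵥ e = z • e) (hf : G *ᵥ f = star z • f) : star e ⬝ᵥ f = 0 := by
  have h := star_dotProduct_mulVec hG e f
  rw [he, hf, star_smul, smul_dotProduct, dotProduct_smul, smul_eq_mul, smul_eq_mul] at h
  have h' : (z - star z) * (star e ⬝ᵥ f) = 0 := by
    linear_combination (-z) * h + (star z * (star e ⬝ᵥ f)) * hz
  exact (mul_eq_zero.1 h').resolve_left hne

/-- In the plane spanned by `φ` and `R φ` the Grover iterate has eigenvalues `e^{±iθ}`, where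
`cos θ = ⟨φ|R|φ⟩`. -/
theorem exists_eigenvector_decomposition {R : Matrix ι ι ℂ} (hR : R.IsHermitian)
    (hR' : R ∈ unitaryGroup ι ℂ) {φ : ι → ℂ} (hφ : ∑ i, ‖φ i‖ ^ 2 = 1) :
    ∃ (z : ℂ) (e f : ι → ℂ), ‖z‖ = 1 ∧ z.re = expectation R φ ∧ e + f = φ ∧
      groverIterate R φ *ᵥ e = z • e ∧ groverIterate R φ *ᵥ f = star z • f ∧
      star e ⬝ᵥ f = 0 := by
  have hle := abs_expectation_le_one hR' hφ
  have hG := groverIterate_mem_unitaryGroup hR' hφ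
  have hsq := groverIterate_mulVec_mulVec hR hR' hφ
  have hself := groverIterate_mulVec_self hR φ
  have hdeg := mulVec_eq_of_expectation_sq hR hR' hφ
  set a := expectation R φ
  set G := groverIterate R φ
  -- When `sin θ = 0` the two eigenvalues coincide, and `φ` itself is an eigenvector of `R` and of
  -- `G`; the second component is then taken to be `0`.
  by_cases h1 : a ^ 2 = 1
  · refine ⟨a, φ, 0, ?_, Complex.ofReal_re a, add_zero _, ?_, by simp, by simp⟩
    · rw [Complex.norm_real, Real.norm_eq_abs]
      exact (pow_eq_one_iff_of_nonneg (abs_nonneg a) two_ne_zero).1 (by rwa [sq_abs])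
    · rw [hself, hdeg h1]
      module
  · have hlt : a ^ 2 < 1 := lt_of_le_of_ne ((sq_le_one_iff_abs_le_one a).2 hle) h1
    set b := Real.sqrt (1 - a ^ 2)
    have hb : b ^ 2 = 1 - a ^ 2 := Real.sq_sqrt (by linarith)
    have hb0 : b ≠ 0 := (Real.sqrt_pos.2 (by linarith)).ne'
    set z : ℂ := ⟨a, b⟩
    have hsum : z + star z = 2 * a := by
      apply Complex.ext <;> simp [z, two_mul]
    have hnorm : ‖z‖ = 1 := by
      rw [← sq_eq_sq₀ (norm_nonneg _) zero_le_one, ← Complex.normSq_eq_norm_sq,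
        Complex.normSq_mk]
      linarith
    have hmul : z * star z = 1 := by
      rw [RCLike.star_def, Complex.mul_conj', hnorm]
      norm_num
    have hne : z - star z ≠ 0 := by
      intro h
      have := congrArg Complex.im h
      simp [z] at this
      exact hb0 (by linarith)
    set w := G *ᵥ φ
    have hzz : G *ᵥ w = (z + star z) • w - φ := by rw [hsum]; exact hsq
    -- The spectral projections of `φ`, by Lagrange interpolation: `(G - z̄)φ / (z - z̄)` and `(G -
    -- z)φ / (z̄ - z)`.
    set e := (z - star z)⁻¹ • (w - star z • φ)
    set f := -((z - star z)⁻¹ • (w - z • φ))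
    have he : G *ᵥ e = z • e := by
      rw [mulVec_smul, mulVec_sub, mulVec_smul, hzz, smul_comm z]
      congr 1
      calc _ = z • w - (1 : ℂ) • φ := by module
        _ = _ := by rw [← hmul]; module
    have hf : G *ᵥ f = star z • f := by
      rw [mulVec_neg, mulVec_smul, mulVec_sub, mulVec_smul, hzz, smul_neg, smul_comm (star z)]
      congr 2
      calc _ = star z • w - (1 : ℂ) • φ := by module
        _ = _ := by rw [← hmul]; module
    refine ⟨z, e, f, hnorm, rfl, ?_, he, hf,
      star_dotProduct_eq_zero_of_eigenvectors hG hmul hne he hf⟩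
    calc _ = ((z - star z)⁻¹ * (z - star z)) • φ := by module
      _ = φ := by rw [inv_mul_cancel₀ hne, one_smul]

end Grover

/-! ### The Fourier transform as sampling of a polynomial on the unit circle. -/

section Fourier

open Matrix Polynomial

/-- The root of unity `e^{2πi/M}`. -/
def rootOfUnity (M : ℕ) : ℂ := Complex.exp (2 * Real.pi * Complex.I / M)

theorem rootOfUnity_isPrimitiveRoot (M : ℕ) [NeZero M] : IsPrimitiveRoot (rootOfUnity M) M :=
  Complex.isPrimitiveRoot_exp M (NeZero.ne M)

theorem norm_rootOfUnity_pow (M : ℕ) [NeZero M] (j : ℕ) : ‖rootOfUnity M ^ j‖ = 1 := by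
  rw [norm_pow, (rootOfUnity_isPrimitiveRoot M).norm'_eq_one (NeZero.ne M), one_pow]

variable {M : ℕ} {κ : Type} (σ : κ ≃ Fin M)

/-- The inverse quantum Fourier transform on `ℂ ^ M`, with basis labels numbered by `σ`. -/
def fourierMatrix : Matrix κ κ ℂ := fun j m =>
  ((Real.sqrt M)⁻¹ : ℝ) * star (rootOfUnity M ^ (σ j : ℕ)) ^ (σ m : ℕ)

variable [Fintype κ]

/-- The Fourier transform of the coefficients of a polynomial. -/
theorem sum_fourierMatrix_mul_coeff {P : ℂ[X]} (hP : P.natDegree < M) (z : ℂ) (j : κ) :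
    ∑ m, fourierMatrix σ j m * (P.coeff (σ m) * z ^ (σ m : ℕ)) =
      ((Real.sqrt M)⁻¹ : ℝ) * P.eval (z * star (rootOfUnity M ^ (σ j : ℕ))) := by
  rw [eval_eq_sum_range' hP, ← Fin.sum_univ_eq_sum_range
    (fun m => P.coeff m * (z * star (rootOfUnity M ^ (σ j : ℕ))) ^ m) M, ← σ.sum_comp,
    Finset.mul_sum]
  refine Finset.sum_congr rfl fun m _ => ?_
  rw [fourierMatrix, mul_pow]
  ring

variable [NeZero M] [DecidableEq κ]

/-- Off the diagonal the entries of `F F*` are geometric sums of a nontrivial `M`-th root of unity,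
hence zero. -/
theorem fourierMatrix_mem_unitaryGroup : fourierMatrix σ ∈ unitaryGroup κ ℂ := by
  have hM : (M : ℝ) ≠ 0 := Nat.cast_ne_zero.2 (NeZero.ne M)
  rw [mem_unitaryGroup_iff]
  ext j k
  set ω := rootOfUnity M
  set c : ℂ := star (ω ^ (σ j : ℕ)) * ω ^ (σ k : ℕ)
  have hs : ((Real.sqrt M)⁻¹ : ℝ) * ((Real.sqrt M)⁻¹ : ℝ) = (M : ℝ)⁻¹ := by
    rw [← mul_inv, Real.mul_self_sqrt (Nat.cast_nonneg M)]
  have hr : star (((Real.sqrt M)⁻¹ : ℝ) : ℂ) = ((Real.sqrt M)⁻¹ : ℝ) := Complex.conj_ofReal _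
  have h1 : (fourierMatrix σ * star (fourierMatrix σ)) j k =
      (M : ℂ)⁻¹ * ∑ m ∈ Finset.range M, c ^ m := by
    rw [mul_apply, ← Fin.sum_univ_eq_sum_range (fun m => c ^ m) M, ← σ.sum_comp, Finset.mul_sum]
    refine Finset.sum_congr rfl fun m _ => ?_
    rw [star_apply, fourierMatrix, fourierMatrix, star_mul', star_pow (star _), star_star,
      hr, mul_mul_mul_comm, ← Complex.ofReal_mul,
      hs, mul_pow]
    push_cast
    rfl
  rw [h1, one_apply]
  have hω := rootOfUnity_isPrimitiveRoot M
  by_cases h : j = k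
  · subst h
    have hc : c = 1 := by
      change star _ * _ = _
      rw [RCLike.star_def, Complex.conj_mul', norm_rootOfUnity_pow]
      norm_num
    have hM' : (M : ℂ) ≠ 0 := Nat.cast_ne_zero.2 (NeZero.ne M)
    simp [hc, hM']
  · rw [if_neg h]
    have hc : c ≠ 1 := by
      intro hc
      apply h
      apply σ.injective
      apply Fin.ext
      refine hω.pow_inj (σ j).2 (σ k).2 ?_
      have h2 : ω ^ (σ j : ℕ) * star (ω ^ (σ j : ℕ)) = 1 := by
        rw [RCLike.star_def, Complex.mul_conj', norm_rootOfUnity_pow]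
        norm_num
      linear_combination (-ω ^ (σ j : ℕ)) * hc + ω ^ (σ k : ℕ) * h2
    have hcM : c ^ M = 1 := by
      have hp : ∀ i, (ω ^ i) ^ M = 1 := fun i => by rw [pow_right_comm, hω.pow_eq_one, one_pow]
      rw [mul_pow, ← star_pow, hp, hp, star_one, one_mul]
    rw [geom_sum_eq hc, hcM]
    simp

/-- Parseval's identity for the values of a polynomial on a rotated grid of the unit circle. -/
theorem sum_norm_sq_eval {P : ℂ[X]} (hP : P.natDegree < M) {z : ℂ} (hz : ‖z‖ = 1) :
    ∑ j : κ, ‖P.eval (z * star (rootOfUnity M ^ (σ j : ℕ)))‖ ^ 2 =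
      M * ∑ m ∈ Finset.range M, ‖P.coeff m‖ ^ 2 := by
  have h := sum_norm_sq_mulVec (fourierMatrix_mem_unitaryGroup σ)
    (fun m => P.coeff (σ m) * z ^ (σ m : ℕ))
  simp only [mulVec, dotProduct, sum_fourierMatrix_mul_coeff σ hP, norm_mul, norm_pow, hz,
    one_pow, mul_one, Complex.norm_real, mul_pow, Real.norm_eq_abs, sq_abs, inv_pow,
    Real.sq_sqrt (Nat.cast_nonneg M), ← Finset.mul_sum] at h
  rw [σ.sum_comp (fun m => ‖P.coeff m‖ ^ 2),
    Fin.sum_univ_eq_sum_range (fun m => ‖P.coeff m‖ ^ 2) M] at h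
  rw [← h, mul_inv_cancel_left₀ (Nat.cast_ne_zero.2 (NeZero.ne M))]

end Fourier

/-! ### The window polynomial and the tail of the estimated phase. -/

section Window

open Polynomial

/-- The normalized Dirichlet kernel `(1 + X + ⋯ + X ^ (K - 1)) / K`. -/
def dirichletPolynomial (K : ℕ) : ℂ[X] := C ((K : ℂ)⁻¹) * ∑ i ∈ Finset.range K, X ^ i

theorem coeff_dirichletPolynomial (K m : ℕ) :
    (dirichletPolynomial K).coeff m = if m < K then (K : ℂ)⁻¹ else 0 := by
  simp [dirichletPolynomial, coeff_C_mul, coeff_X_pow]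

theorem natDegree_dirichletPolynomial_le (K : ℕ) : (dirichletPolynomial K).natDegree ≤ K - 1 := by
  refine natDegree_le_iff_coeff_eq_zero.2 fun m hm => ?_
  rw [coeff_dirichletPolynomial, if_neg (by omega)]

theorem eval_one_dirichletPolynomial {K : ℕ} (hK : K ≠ 0) :
    (dirichletPolynomial K).eval 1 = 1 := by
  have : (K : ℂ) ≠ 0 := Nat.cast_ne_zero.2 hK
  simp [dirichletPolynomial, eval_finsetSum, this]

/-- Decay of the Dirichlet kernel away from `1`. -/
theorem norm_eval_dirichletPolynomial_le {K : ℕ} {z : ℂ} (hz : ‖z‖ = 1) {η : ℝ} (hη : 0 < η)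
    (h : η ≤ ‖z - 1‖) : ‖(dirichletPolynomial K).eval z‖ ≤ 2 / (K * η) := by
  have hne : z ≠ 1 := by
    rintro rfl
    simp at h
    linarith
  rw [dirichletPolynomial, eval_mul, eval_C, eval_finsetSum]
  simp only [eval_pow, eval_X]
  rw [geom_sum_eq hne, norm_mul, norm_div, norm_inv, Complex.norm_natCast, inv_mul_eq_div,
    div_div, mul_comm]
  have h2 : ‖z ^ K - 1‖ ≤ 2 := by
    refine (norm_sub_le _ _).trans ?_
    rw [norm_pow, hz]
    norm_num
  rcases Nat.eq_zero_or_pos K with rfl | hK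
  · simp
  · have : (0 : ℝ) < K := Nat.cast_pos.2 hK
    gcongr

/-- The window function of the phase estimation, a power of the Dirichlet kernel. -/
def windowPolynomial (K L : ℕ) : ℂ[X] := dirichletPolynomial K ^ L

theorem natDegree_windowPolynomial_le (K L : ℕ) :
    (windowPolynomial K L).natDegree ≤ L * (K - 1) :=
  natDegree_pow_le_of_le L (natDegree_dirichletPolynomial_le K)

/-- All coefficients fit into a counter of size `M`, so the Fourier transform evaluates the
polynomial without truncation. -/
theorem natDegree_windowPolynomial_lt {K L M : ℕ} (hK : K ≠ 0) (hL : L ≠ 0) (hM : K * L ≤ M) :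
    (windowPolynomial K L).natDegree < M := by
  refine (natDegree_windowPolynomial_le K L).trans_lt (lt_of_lt_of_le ?_ hM)
  rw [mul_comm K]
  exact Nat.mul_lt_mul_of_pos_left (by omega) (by omega)

/-- The squared norm of the window. -/
def windowWeight (K L M : ℕ) : ℝ := ∑ m ∈ Finset.range M, ‖(windowPolynomial K L).coeff m‖ ^ 2

/-- The coefficients sum to the value `1` at `1`, so Cauchy–Schwarz applies. The bound lets the
normalization of `phaseProb` be dropped in the tail estimate. -/
theorem one_le_mul_windowWeight {K L M : ℕ} (hK : K ≠ 0) (hL : L ≠ 0) (hM : K * L ≤ M) :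
    1 ≤ M * windowWeight K L M := by
  have h1 : (windowPolynomial K L).eval 1 = 1 := by
    rw [windowPolynomial, eval_pow, eval_one_dirichletPolynomial hK, one_pow]
  rw [eval_eq_sum_range' (natDegree_windowPolynomial_lt hK hL hM)] at h1
  simp only [one_pow, mul_one] at h1
  have h2 : (1 : ℝ) ≤ ∑ m ∈ Finset.range M, ‖(windowPolynomial K L).coeff m‖ := by
    rw [← norm_one (α := ℂ), ← h1]
    exact norm_sum_le _ _
  have h3 := sq_sum_le_card_mul_sum_sq (s := Finset.range M)
    (f := fun m => ‖(windowPolynomial K L).coeff m‖)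
  rw [Finset.card_range] at h3
  exact (one_le_pow₀ h2).trans h3

theorem windowWeight_pos {K L M : ℕ} (hK : K ≠ 0) (hL : L ≠ 0) (hM : K * L ≤ M) :
    0 < windowWeight K L M := by
  have := one_le_mul_windowWeight hK hL hM
  by_contra! h
  nlinarith [mul_nonpos_of_nonneg_of_nonpos (Nat.cast_nonneg (α := ℝ) M) h]

variable {M : ℕ} {κ : Type} (σ : κ ≃ Fin M)

/-- The probability that phase estimation of `z` ends in the grid point with label `j`. -/
def phaseProb (K L : ℕ) (z : ℂ) (j : κ) : ℝ :=
  ‖(windowPolynomial K L).eval (z * star (rootOfUnity M ^ (σ j : ℕ)))‖ ^ 2 /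
    (M * windowWeight K L M)

variable [NeZero M] [Fintype κ] [DecidableEq κ]

theorem sum_phaseProb {K L : ℕ} (hK : K ≠ 0) (hL : L ≠ 0) (hM : K * L ≤ M) {z : ℂ}
    (hz : ‖z‖ = 1) : ∑ j, phaseProb σ K L z j = 1 := by
  have h := one_le_mul_windowWeight hK hL hM
  simp only [phaseProb, ← Finset.sum_div]
  rw [sum_norm_sq_eval σ (natDegree_windowPolynomial_lt hK hL hM) hz, ← windowWeight,
    div_self (by linarith)]

/-- The tail of the distribution of the estimated phase. -/
theorem sum_phaseProb_le {K L : ℕ} (hK : K ≠ 0) (hM : K * (L + 1) ≤ M) {z : ℂ}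
    (hz : ‖z‖ = 1) {η : ℝ} (hη : 0 < η) (hKη : 4 ≤ K * η) {s : Finset κ}
    (hs : ∀ j ∈ s, η ≤ ‖z - rootOfUnity M ^ (σ j : ℕ)‖) :
    ∑ j ∈ s, phaseProb σ K (L + 1) z j ≤ (1 / 4) ^ L * (M / K) := by
  have hw := one_le_mul_windowWeight hK (Nat.succ_ne_zero L) hM
  have hK0 : (0 : ℝ) < K := by positivity
  set ω := rootOfUnity M
  set D := dirichletPolynomial K
  have hD : ∀ j ∈ s, phaseProb σ K (L + 1) z j ≤
      (1 / 4) ^ L * ‖D.eval (z * star (ω ^ (σ j : ℕ)))‖ ^ 2 := by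
    intro j hj
    have hω : ω ^ (σ j : ℕ) * star (ω ^ (σ j : ℕ)) = 1 := by
      rw [RCLike.star_def, Complex.mul_conj', norm_rootOfUnity_pow]
      norm_num
    have hstar : ‖star (ω ^ (σ j : ℕ))‖ = 1 := by rw [norm_star, norm_rootOfUnity_pow]
    have h1 : ‖D.eval (z * star (ω ^ (σ j : ℕ)))‖ ≤ 1 / 2 := by
      refine (norm_eval_dirichletPolynomial_le (by rw [norm_mul, hz, hstar, one_mul]) hη ?_).trans
        ?_
      · rw [← hω, ← sub_mul, norm_mul, hstar, mul_one]
        exact hs j hj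
      · rw [div_le_div_iff₀ (by linarith) (by norm_num)]
        linarith
    calc phaseProb σ K (L + 1) z j
        ≤ ‖(windowPolynomial K (L + 1)).eval (z * star (ω ^ (σ j : ℕ)))‖ ^ 2 :=
          div_le_self (sq_nonneg _) hw
      -- `L` of the factors are bounded by `1/4` each. The last one is kept, so that Parseval sums
      -- it over the grid to `M/K` rather than to something of order `M`.
      _ = (‖D.eval (z * star (ω ^ (σ j : ℕ)))‖ ^ 2) ^ L *
            ‖D.eval (z * star (ω ^ (σ j : ℕ)))‖ ^ 2 := by
          rw [windowPolynomial, eval_pow, norm_pow]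
          ring
      _ ≤ (1 / 4) ^ L * ‖D.eval (z * star (ω ^ (σ j : ℕ)))‖ ^ 2 := by
          gcongr
          calc _ ≤ (1 / 2 : ℝ) ^ 2 := by gcongr
            _ = 1 / 4 := by norm_num
  have hKM : K ≤ M := le_trans (Nat.le_mul_of_pos_right K (Nat.succ_pos L)) hM
  have hsum : ∑ m ∈ Finset.range M, ‖D.coeff m‖ ^ 2 = (K : ℝ)⁻¹ := by
    simp only [D, coeff_dirichletPolynomial, apply_ite norm, norm_zero, norm_inv,
      Complex.norm_natCast, ite_pow, ne_eq, OfNat.ofNat_ne_zero, not_false_eq_true, zero_pow]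
    rw [← Finset.sum_filter, Finset.sum_const, nsmul_eq_mul]
    have : Finset.filter (· < K) (Finset.range M) = Finset.range K := by
      ext m
      simp only [Finset.mem_filter, Finset.mem_range]
      omega
    rw [this, Finset.card_range]
    field_simp
  calc ∑ j ∈ s, phaseProb σ K (L + 1) z j
      ≤ ∑ j ∈ s, (1 / 4) ^ L * ‖D.eval (z * star (ω ^ (σ j : ℕ)))‖ ^ 2 := Finset.sum_le_sum hD
    _ ≤ ∑ j, (1 / 4) ^ L * ‖D.eval (z * star (ω ^ (σ j : ℕ)))‖ ^ 2 :=
        Finset.sum_le_sum_of_subset_of_nonneg (Finset.subset_univ s)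
          fun _ _ _ => by positivity
    _ = (1 / 4) ^ L * (M / K) := by
        have hdeg : D.natDegree < M :=
          (natDegree_dirichletPolynomial_le K).trans_lt (by omega)
        rw [← Finset.mul_sum, sum_norm_sq_eval σ hdeg hz, hsum, div_eq_mul_inv (M : ℝ)]

end Window

/-! ### Circuits for controlled powers of the Grover iterate. -/

section Circuits

open Matrix

open scoped Kronecker

/-- The state whose branch at the ancilla basis state `b` is `χ b`. -/
def branches {ι κ : Type} (χ : κ → ι → ℂ) : ι × κ → ℂ := fun p => χ p.2 p.1

theorem branches_apply {ι κ : Type} (χ : κ → ι → ℂ) (r : ι) (b : κ) :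
    branches χ (r, b) = χ b r := rfl

theorem ket_prod {ι κ : Type} [DecidableEq ι] [DecidableEq κ] (r : ι) (b : κ) :
    ket (r, b) = branches fun m => ket b m • ket r := by
  ext ⟨r', b'⟩
  by_cases h : b' = b <;> by_cases h' : r' = r <;> simp [ket, branches, h, h']

variable {ι κ Reg : Type} [Fintype ι] [Fintype κ]

theorem kronecker_mulVec_branches [DecidableEq ι] (W : Matrix κ κ ℂ) (χ : κ → ι → ℂ) :
    ((1 : Matrix ι ι ℂ) ⊗ₖ W) *ᵥ branches χ = branches fun b => ∑ m, W b m • χ m := by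
  ext ⟨r, b⟩
  simp only [mulVec, dotProduct, branches, Fintype.sum_prod_type]
  rw [Finset.sum_comm]
  simp [one_apply, ite_mul, Finset.sum_apply]

variable [DecidableEq κ] [Fintype Reg] [DecidableEq Reg]

/-- A unit vector is the image of a basis state under a unitary matrix. -/
theorem exists_unitary_mulVec_ket {c : κ → ℂ} (hc : ∑ i, ‖c i‖ ^ 2 = 1) (k : κ) :
    ∃ W ∈ unitaryGroup κ ℂ, W *ᵥ ket k = c := by
  have hv : Orthonormal ℂ (({k} : Set κ).domRestrict fun _ => WithLp.toLp 2 c) := by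
    constructor
    · intro _
      exact norm_toLp_eq_one hc
    · intro i j hij
      exact absurd (Subsingleton.elim i j) hij
  obtain ⟨b, hb⟩ := hv.exists_orthonormalBasis_extension_of_card_eq (by simp)
  refine ⟨_, (EuclideanSpace.basisFun κ ℂ).toMatrix_orthonormalBasis_mem_unitary b, ?_⟩
  ext i
  rw [ket, mulVec_single_one, col_apply, Module.Basis.toMatrix_apply, hb k rfl]
  simp

theorem blockDiagonal_mulVec_branches (f : κ → Matrix ι ι ℂ) (χ : κ → ι → ℂ) :
    blockDiagonal f *ᵥ branches χ = branches fun b => f b *ᵥ χ b := by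
  ext ⟨r, b⟩
  simp [mulVec, dotProduct, branches, blockDiagonal_apply, Fintype.sum_prod_type, ite_mul]

theorem blockDiagonal_mem_unitaryGroup [DecidableEq ι] {f : κ → Matrix ι ι ℂ}
    (hf : ∀ b, f b ∈ unitaryGroup ι ℂ) : blockDiagonal f ∈ unitaryGroup (ι × κ) ℂ := by
  rw [mem_unitaryGroup_iff, star_eq_conjTranspose, blockDiagonal_conjTranspose,
    ← blockDiagonal_mul, ← blockDiagonal_one]
  congr 1
  funext b
  exact mem_unitaryGroup_iff.1 (hf b)

variable {a : ℕ}

/-- The state after some steps. -/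
def runSteps (R U : Matrix Reg Reg ℂ) (l : List (QStep a Reg)) (ψ : Reg × (Fin a → Bool) → ℂ) :
    Reg × (Fin a → Bool) → ℂ :=
  l.foldl (fun ψ s => s.matrix R U *ᵥ ψ) ψ

theorem runSteps_append (R U : Matrix Reg Reg ℂ) (l l' : List (QStep a Reg))
    (ψ : Reg × (Fin a → Bool) → ℂ) :
    runSteps R U (l ++ l') ψ = runSteps R U l' (runSteps R U l ψ) :=
  List.foldl_append

theorem runSteps_cons (R U : Matrix Reg Reg ℂ) (s : QStep a Reg) (l : List (QStep a Reg))
    (ψ : Reg × (Fin a → Bool) → ℂ) :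
    runSteps R U (s :: l) ψ = runSteps R U l (s.matrix R U *ᵥ ψ) := rfl

theorem runSteps_nil (R U : Matrix Reg Reg ℂ) (ψ : Reg × (Fin a → Bool) → ℂ) :
    runSteps R U [] ψ = ψ := rfl

/-- A unitary gate on the ancillas. -/
def ancillaGate (W : unitaryGroup (Fin a → Bool) ℂ) : QStep a Reg :=
  .gate ⟨(1 : Matrix Reg Reg ℂ) ⊗ₖ (W : Matrix (Fin a → Bool) (Fin a → Bool) ℂ),
    kronecker_mem_unitary (one_mem _) W.2⟩

/-- The reflection about the basis state `r₀`, controlled by the ancilla `i`. -/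
def controlledReflection (r₀ : Reg) (i : Fin a) : QStep a Reg :=
  .gate ⟨blockDiagonal fun b => if b i = true then reflectionAbout (ket r₀) else 1,
    blockDiagonal_mem_unitaryGroup fun b => by
      split_ifs
      · exact reflectionAbout_mem_unitaryGroup (sum_norm_sq_ket r₀)
      · exact one_mem _⟩

/-- The Grover iterate, controlled by the ancilla `i`. -/
def groverSteps (r₀ : Reg) (i : Fin a) : List (QStep a Reg) :=
  [.call (some i) .reflect, .call none .prepareInv, controlledReflection r₀ i,
    .call none .prepare]

/-- Only the oracle and the middle reflection need a control: on branches where it is off, `U` and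
its inverse cancel. -/
theorem runSteps_groverSteps (R U : Matrix Reg Reg ℂ) (hU : U ∈ unitaryGroup Reg ℂ) (r₀ : Reg)
    (i : Fin a) (χ : (Fin a → Bool) → Reg → ℂ) :
    runSteps R U (groverSteps r₀ i) (branches χ) =
      branches fun b => groverIterate R (U *ᵥ ket r₀) ^ (b i).toNat *ᵥ χ b := by
  simp only [groverSteps, runSteps_cons, runSteps_nil, QStep.matrix, controlledReflection,
    controlledMatrix, OracleCall.matrix, blockDiagonal_mulVec_branches, mulVec_mulVec]
  congr 1
  funext b
  cases h : b i
  · have hU' : U * Uᴴ = 1 := mem_unitaryGroup_iff.1 hU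
    simp [hU']
  · simp only [if_true, Bool.toNat_true, pow_one, groverIterate,
      ← mul_reflectionAbout_mul_conjTranspose U hU, mul_assoc]

/-- Powers of the Grover iterate, with the exponent in the binary counter formed by the
ancillas. -/
def phaseSteps (r₀ : Reg) (l : List (Fin a)) : List (QStep a Reg) :=
  l.flatMap fun i : Fin a => (List.replicate (2 ^ (i : ℕ)) (groverSteps r₀ i)).flatten

theorem runSteps_replicate (R U : Matrix Reg Reg ℂ) (hU : U ∈ unitaryGroup Reg ℂ) (r₀ : Reg)
    (i : Fin a) (χ : (Fin a → Bool) → Reg → ℂ) (n : ℕ) :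
    runSteps R U (List.replicate n (groverSteps r₀ i)).flatten (branches χ) =
      branches fun b => groverIterate R (U *ᵥ ket r₀) ^ ((b i).toNat * n) *ᵥ χ b := by
  induction n with
  | zero => simp [runSteps_nil]
  | succ n ih =>
    rw [List.replicate_succ', List.flatten_append, runSteps_append, ih, List.flatten_singleton,
      runSteps_groverSteps R U hU]
    simp only [mulVec_mulVec, ← pow_add]
    congr! 4
    ring

theorem runSteps_phaseSteps (R U : Matrix Reg Reg ℂ) (hU : U ∈ unitaryGroup Reg ℂ) (r₀ : Reg)
    (l : List (Fin a)) (χ : (Fin a → Bool) → Reg → ℂ) :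
    runSteps R U (phaseSteps r₀ l) (branches χ) =
      branches fun b => groverIterate R (U *ᵥ ket r₀) ^
        (l.map fun i : Fin a => (b i).toNat * 2 ^ (i : ℕ)).sum *ᵥ χ b := by
  induction l generalizing χ with
  | nil => simp [phaseSteps, runSteps_nil]
  | cons i l ih =>
    rw [phaseSteps, List.flatMap_cons, runSteps_append, runSteps_replicate R U hU]
    refine (ih _).trans ?_
    simp only [mulVec_mulVec, ← pow_add, List.map_cons, List.sum_cons]
    congr! 4
    ring

/-- Binary numbers. -/
def counterEquiv (a : ℕ) : (Fin a → Bool) ≃ Fin (2 ^ a) :=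
  (Equiv.arrowCongr (Equiv.refl _) finTwoEquiv.symm).trans finFunctionFinEquiv

theorem counterEquiv_apply (b : Fin a → Bool) :
    (counterEquiv a b : ℕ) = ((List.finRange a).map fun i => (b i).toNat * 2 ^ (i : ℕ)).sum := by
  rw [counterEquiv, Equiv.trans_apply, finFunctionFinEquiv_apply, ← Fin.sum_univ_def]
  refine Finset.sum_congr rfl fun i _ => ?_
  congr 1
  cases h : b i <;> simp [finTwoEquiv, h]

/-- The circuit contains `2 ^ a - 1` Grover iterates of three calls each; the additive form avoids
subtraction in `ℕ`. -/
theorem sum_uses_phaseSteps (r₀ : Reg) :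
    ((phaseSteps r₀ (List.finRange a)).map QStep.uses).sum + 3 = 3 * 2 ^ a := by
  have h1 : ∀ l : List (Fin a), ((phaseSteps r₀ l).map QStep.uses).sum =
      (l.map fun i : Fin a => 3 * 2 ^ (i : ℕ)).sum := by
    intro l
    induction l with
    | nil => rfl
    | cons i l ih =>
      rw [phaseSteps, List.flatMap_cons, List.map_append, List.sum_append, List.map_cons,
        List.sum_cons, ← ih]
      congr 1
      rw [List.map_flatten, List.map_replicate, List.sum_flatten, List.map_replicate,
        List.sum_replicate, smul_eq_mul, mul_comm]
      rfl
  rw [h1, ← Fin.sum_univ_def, ← Finset.mul_sum, Fin.sum_univ_eq_sum_range (fun i => 2 ^ i)]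
  have h2 : ∑ i ∈ Finset.range a, 2 ^ i + 1 = 2 ^ a := by
    have := Nat.geomSum_eq (le_refl 2) a
    have := Nat.one_le_two_pow (n := a)
    omega
  linarith

end Circuits

/-! ### Phase estimation and the distribution of its outcome. -/

section PhaseEstimation

open Matrix Polynomial

theorem pow_mulVec_eigenvector {ι : Type} [Fintype ι] [DecidableEq ι] {G : Matrix ι ι ℂ} {z : ℂ}
    {e : ι → ℂ} (h : G *ᵥ e = z • e) (m : ℕ) : G ^ m *ᵥ e = z ^ m • e := by
  induction m with
  | zero => simp
  | succ m ih => rw [pow_succ, ← mulVec_mulVec, h, mulVec_smul, ih, smul_smul, pow_succ']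

variable {Reg : Type} [Fintype Reg] [DecidableEq Reg]

/-- Phase estimation of the Grover iterate with `a` bits, where the gate `W` prepares the initial
state of the ancillas. -/
def phaseEstimation (r₀ : Reg) (a : ℕ) (W : unitaryGroup (Fin a → Bool) ℂ) :
    QueryAlgorithm Reg where
  ancillas := a
  steps := ancillaGate W :: .call none .prepare :: (phaseSteps r₀ (List.finRange a) ++
    [ancillaGate ⟨fourierMatrix (counterEquiv a), fourierMatrix_mem_unitaryGroup _⟩])
  output p := (1 - (rootOfUnity (2 ^ a) ^ (counterEquiv a p.2 : ℕ)).re) / 2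

variable {a : ℕ}

theorem uses_phaseEstimation_le (r₀ : Reg) (W : unitaryGroup (Fin a → Bool) ℂ) :
    (phaseEstimation r₀ a W).uses ≤ 3 * 2 ^ a := by
  have h := sum_uses_phaseSteps (a := a) r₀
  have h' : (phaseEstimation r₀ a W).uses =
      1 + ((phaseSteps r₀ (List.finRange a)).map QStep.uses).sum := by
    simp [phaseEstimation, QueryAlgorithm.uses, QStep.uses, ancillaGate]
  omega

theorem finalState_phaseEstimation (R : Matrix Reg Reg ℂ) {U : Matrix Reg Reg ℂ}
    (hU : U ∈ unitaryGroup Reg ℂ) (r₀ : Reg) (W : unitaryGroup (Fin a → Bool) ℂ) :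
    (phaseEstimation r₀ a W).finalState R U r₀ =
      branches (κ := Fin a → Bool) fun b =>
      ∑ m, fourierMatrix (counterEquiv a) b m •
        ((W.1 *ᵥ ket fun _ => false) m •
          (groverIterate R (U *ᵥ ket r₀) ^ (counterEquiv a m : ℕ) *ᵥ (U *ᵥ ket r₀))) := by
  change runSteps R U (ancillaGate W :: .call none .prepare :: (phaseSteps r₀ (List.finRange a) ++
    [ancillaGate ⟨fourierMatrix (counterEquiv a), fourierMatrix_mem_unitaryGroup _⟩]))
    (ket (r₀, fun _ => false)) = _
  have h1 : ∀ b, ∑ m, W.1 b m • ket (fun _ => false) m • ket r₀ =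
      (W.1 *ᵥ ket fun _ => false) b • ket r₀ := by
    intro b
    simp only [mulVec, dotProduct, Finset.sum_smul, smul_smul]
  rw [runSteps_cons, runSteps_cons, runSteps_append, runSteps_cons, runSteps_nil, ket_prod]
  simp only [QStep.matrix, ancillaGate, controlledMatrix, OracleCall.matrix]
  rw [kronecker_mulVec_branches, blockDiagonal_mulVec_branches, runSteps_phaseSteps R U hU,
    kronecker_mulVec_branches]
  simp only [← counterEquiv_apply, h1, mulVec_smul]

/-- The initial state of the ancillas for the window function. -/
theorem sum_norm_sq_window {K L : ℕ} (hK : K ≠ 0) (hL : L ≠ 0) (hM : K * L ≤ 2 ^ a) :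
    ∑ m, ‖((Real.sqrt (windowWeight K L (2 ^ a)))⁻¹ : ℝ) *
      (windowPolynomial K L).coeff (counterEquiv a m)‖ ^ 2 = 1 := by
  have hw := windowWeight_pos hK hL hM
  simp only [norm_mul, mul_pow, Complex.norm_real, Real.norm_eq_abs, sq_abs, inv_pow,
    Real.sq_sqrt hw.le, ← Finset.mul_sum]
  rw [(counterEquiv a).sum_comp (fun m => ‖(windowPolynomial K L).coeff m‖ ^ 2),
    Fin.sum_univ_eq_sum_range (fun m => ‖(windowPolynomial K L).coeff m‖ ^ 2)]
  exact inv_mul_cancel₀ hw.ne'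

/-- The distribution of the measured counter. -/
theorem sum_norm_sq_finalState {K L : ℕ} (hK : K ≠ 0) (hL : L ≠ 0) (hM : K * L ≤ 2 ^ a)
    {R U : Matrix Reg Reg ℂ} (hU : U ∈ unitaryGroup Reg ℂ) (r₀ : Reg)
    (W : unitaryGroup (Fin a → Bool) ℂ)
    (hW : (W.1 *ᵥ ket fun _ => false) = fun m =>
      ((Real.sqrt (windowWeight K L (2 ^ a)))⁻¹ : ℝ) *
        (windowPolynomial K L).coeff (counterEquiv a m))
    {z : ℂ} {e f : Reg → ℂ} (hef : e + f = U *ᵥ ket r₀)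
    (he : groverIterate R (U *ᵥ ket r₀) *ᵥ e = z • e)
    (hf : groverIterate R (U *ᵥ ket r₀) *ᵥ f = star z • f) (horth : star e ⬝ᵥ f = 0)
    (b : Fin a → Bool) :
    ∑ r, ‖(phaseEstimation r₀ a W).finalState R U r₀ (r, b)‖ ^ 2 =
      phaseProb (counterEquiv a) K L z b * ∑ r, ‖e r‖ ^ 2 +
        phaseProb (counterEquiv a) K L (star z) b * ∑ r, ‖f r‖ ^ 2 := by
  have hdeg := natDegree_windowPolynomial_lt hK hL hM
  have hw := windowWeight_pos hK hL hM
  set P := windowPolynomial K L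
  set A := windowWeight K L (2 ^ a)
  set σ := counterEquiv a
  set s : ℂ := (((Real.sqrt A)⁻¹ : ℝ) : ℂ)
  set t : ℂ := (((Real.sqrt (2 ^ a : ℕ))⁻¹ : ℝ) : ℂ)
  have hbranch : ∀ r, (phaseEstimation r₀ a W).finalState R U r₀ (r, b) =
      ((s * (t * P.eval (z * star (rootOfUnity (2 ^ a) ^ (σ b : ℕ))))) • e +
        (s * (t * P.eval (star z * star (rootOfUnity (2 ^ a) ^ (σ b : ℕ))))) • f) r := by
    intro r
    refine (congrFun (finalState_phaseEstimation R hU r₀ W) (r, b)).trans ?_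
    refine (branches_apply _ r b).trans ?_
    rw [hW, ← sum_fourierMatrix_mul_coeff σ hdeg,
      ← sum_fourierMatrix_mul_coeff σ hdeg, Finset.mul_sum, Finset.mul_sum,
      Finset.sum_smul, Finset.sum_smul, ← Finset.sum_add_distrib]
    refine congrFun (Finset.sum_congr rfl fun m _ => ?_) r
    -- On each eigenvector the powers of the Grover iterate become powers of a scalar, so the two
    -- components are Fourier transformed separately.
    rw [show groverIterate R (U *ᵥ ket r₀) ^ (σ m : ℕ) *ᵥ (U *ᵥ ket r₀) =
      z ^ (σ m : ℕ) • e + star z ^ (σ m : ℕ) • f by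
        rw [← pow_mulVec_eigenvector he, ← pow_mulVec_eigenvector hf, ← mulVec_add, hef]]
    module
  have hst : ∀ x : ℂ, ‖s * (t * x)‖ ^ 2 = ‖x‖ ^ 2 / ((2 ^ a : ℕ) * A) := by
    intro x
    simp only [norm_mul, mul_pow, s, t, Complex.norm_real, Real.norm_eq_abs, sq_abs, inv_pow,
      Real.sq_sqrt hw.le, Real.sq_sqrt (Nat.cast_nonneg (α := ℝ) (2 ^ a))]
    field_simp
  simp only [hbranch, sum_norm_sq_smul_add_smul horth, hst]
  rfl

end PhaseEstimation

/-! ### Success probability and choice of the window. -/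

section Main

open Matrix

variable {Reg : Type} [Fintype Reg] [DecidableEq Reg]

/-- Phase estimation of the Grover iterate yields the expectation value of the reflection. -/
theorem le_outputProb_phaseEstimation {a K L : ℕ} (hK : K ≠ 0) (hM : K * (L + 1) ≤ 2 ^ a)
    {η : ℝ} (hη : 0 < η) (hKη : 4 ≤ K * η) {R U : Matrix Reg Reg ℂ} (hR : R.IsHermitian)
    (hR' : R ∈ unitaryGroup Reg ℂ) (hU : U ∈ unitaryGroup Reg ℂ) (r₀ : Reg)
    (W : unitaryGroup (Fin a → Bool) ℂ)
    (hW : (W.1 *ᵥ ket fun _ => false) = fun m =>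
      ((Real.sqrt (windowWeight K (L + 1) (2 ^ a)))⁻¹ : ℝ) *
        (windowPolynomial K (L + 1)).coeff (counterEquiv a m))
    {s : Set ℝ} (hs : ∀ u, |u - (1 - expectation R (U *ᵥ ket r₀)) / 2| ≤ η / 2 → u ∈ s) :
    1 - (1 / 4) ^ L * (2 ^ a / K) ≤ (phaseEstimation r₀ a W).outputProb R U r₀ s := by
  classical
  have hφ : ∑ r, ‖(U *ᵥ ket r₀) r‖ ^ 2 = 1 := by rw [sum_norm_sq_mulVec hU, sum_norm_sq_ket]
  obtain ⟨z, e, f, hz, hre, hef, he, hf, horth⟩ := exists_eigenvector_decomposition hR hR' hφ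
  have hsum : ∑ r, ‖e r‖ ^ 2 + ∑ r, ‖f r‖ ^ 2 = 1 := by
    have h := sum_norm_sq_smul_add_smul horth 1 1
    rw [one_smul, one_smul, hef, hφ] at h
    simpa using h.symm
  set σ := counterEquiv a
  set ω := rootOfUnity (2 ^ a)
  set out : (Fin a → Bool) → ℝ := fun b => (1 - (ω ^ (σ b : ℕ)).re) / 2
  set p : (Fin a → Bool) → ℝ := fun b => phaseProb σ K (L + 1) z b * ∑ r, ‖e r‖ ^ 2 +
        phaseProb σ K (L + 1) (star z) b * ∑ r, ‖f r‖ ^ 2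
  have hz' : ‖star z‖ = 1 := by rw [norm_star, hz]
  have hprob : (phaseEstimation r₀ a W).outputProb R U r₀ s =
      ∑ b ∈ Finset.univ.filter fun b => out b ∈ s, p b := by
    rw [Finset.sum_filter, QueryAlgorithm.outputProb]
    refine (Fintype.sum_prod_type _).trans ?_
    rw [Finset.sum_comm]
    refine Finset.sum_congr rfl fun b _ => ?_
    rw [show p b = _ from (sum_norm_sq_finalState hK (Nat.succ_ne_zero L) hM hU r₀ W hW hef he hf
      horth b).symm]
    by_cases h : out b ∈ s
    · rw [if_pos h]
      exact Finset.sum_congr rfl fun r _ => if_pos h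
    · rw [if_neg h]
      exact Finset.sum_eq_zero fun r _ => if_neg h
  have htotal : ∑ b, p b = 1 := by
    simp only [p, Finset.sum_add_distrib, ← Finset.sum_mul]
    rw [sum_phaseProb σ hK (Nat.succ_ne_zero L) hM hz,
      sum_phaseProb σ hK (Nat.succ_ne_zero L) hM hz', one_mul, one_mul, hsum]
  -- A wrong output forces the grid point to be far from both eigenvalues: the difference of real
  -- parts is at most the distance, and `z` and `z̄` share the real part.
  have hfar : ∀ w : ℂ, w.re = expectation R (U *ᵥ ket r₀) →
      ∀ b ∈ Finset.univ.filter fun b => out b ∉ s, η ≤ ‖w - ω ^ (σ b : ℕ)‖ := by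
    intro w hw b hb
    by_contra! hlt
    refine (Finset.mem_filter.1 hb).2 (hs _ ?_)
    have h := (Complex.abs_re_le_norm (w - ω ^ (σ b : ℕ))).trans hlt.le
    rw [Complex.sub_re, hw] at h
    rw [show out b - (1 - expectation R (U *ᵥ ket r₀)) / 2 =
      (expectation R (U *ᵥ ket r₀) - (ω ^ (σ b : ℕ)).re) / 2 by simp only [out]; ring,
      abs_div, abs_two]
    linarith
  have hbad : ∑ b ∈ Finset.univ.filter fun b => out b ∉ s, p b ≤ (1 / 4) ^ L * (2 ^ a / K) := by
    have h1 := sum_phaseProb_le σ hK hM hz hη hKη (hfar z hre)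
    have h2 := sum_phaseProb_le σ hK hM hz' hη hKη (hfar (star z) (by simpa using hre))
    simp only [p, Finset.sum_add_distrib, ← Finset.sum_mul]
    push_cast at h1 h2
    calc _ ≤ (1 / 4) ^ L * (2 ^ a / K) * ∑ r, ‖e r‖ ^ 2 +
          (1 / 4) ^ L * (2 ^ a / K) * ∑ r, ‖f r‖ ^ 2 := by gcongr
      _ = _ := by rw [← mul_add, hsum, mul_one]
  have := Finset.sum_filter_add_sum_filter_not Finset.univ (fun b => out b ∈ s) p
  rw [hprob]
  linarith

/-- The algorithm that uses no black box and outputs `u`. -/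
def constantAlgorithm (Reg : Type) [Fintype Reg] [DecidableEq Reg] (u : ℝ) :
    QueryAlgorithm Reg where
  ancillas := 0
  steps := []
  output _ := u

theorem outputProb_constantAlgorithm {u : ℝ} {s : Set ℝ} (hu : u ∈ s) (R U : Matrix Reg Reg ℂ)
    (r₀ : Reg) : (constantAlgorithm Reg u).outputProb R U r₀ s = 1 := by
  rw [QueryAlgorithm.outputProb, ← sum_norm_sq_ket (r₀, fun _ : Fin 0 => false)]
  exact Finset.sum_congr rfl fun _ _ => if_pos hu

theorem exists_two_pow_near {n : ℕ} (hn : n ≠ 0) : ∃ a, n ≤ 2 ^ a ∧ 2 ^ a ≤ 2 * n := by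
  refine ⟨Nat.log 2 n + 1, (Nat.lt_pow_succ_log_self one_lt_two n).le, ?_⟩
  rw [pow_succ']
  exact Nat.mul_le_mul_left 2 (Nat.pow_log_le_self 2 hn)

/-- The number of factors of the window that makes the failure probability small. -/
theorem exists_window_exponent {δ : ℝ} (hδ : 0 < δ) (hδ1 : δ < 1) :
    ∃ L : ℕ, (1 / 4 : ℝ) ^ L * (2 * (L + 1)) ≤ δ ∧ (L + 1 : ℝ) ≤ 6 * Real.log (2 / δ) := by
  have hlog2 : (1 / 2 : ℝ) < Real.log 2 := by linarith [Real.log_two_gt_d9]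
  have hlog : Real.log 2 ≤ Real.log (2 / δ) :=
    Real.log_le_log (by norm_num) (by rw [le_div_iff₀ hδ]; linarith)
  set y := Real.log (2 / δ) / Real.log 2
  have hy1 : 1 ≤ y := (one_le_div (by linarith)).2 hlog
  have hy2 : y ≤ 2 * Real.log (2 / δ) := by
    rw [div_le_iff₀ (by linarith)]
    nlinarith
  refine ⟨⌈y⌉₊, ?_, ?_⟩
  · have h1 : 2 / δ ≤ 2 ^ ⌈y⌉₊ := by
      rw [← Real.log_le_log_iff (by positivity) (by positivity), Real.log_pow,
        ← div_le_iff₀ (by linarith)]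
      exact Nat.le_ceil y
    -- The linear factor costs one of the two factors `2^{-L}` in `4^{-L}`; the other one is at most
    -- `δ/2`.
    have h2 : ((⌈y⌉₊ : ℝ) + 1) ≤ 2 ^ ⌈y⌉₊ := by exact_mod_cast Nat.lt_two_pow_self (n := ⌈y⌉₊)
    rw [div_le_iff₀ hδ] at h1
    calc (1 / 4 : ℝ) ^ ⌈y⌉₊ * (2 * (⌈y⌉₊ + 1))
        ≤ (1 / 4 : ℝ) ^ ⌈y⌉₊ * (2 * 2 ^ ⌈y⌉₊) := by gcongr
      _ = (1 / 2 : ℝ) ^ ⌈y⌉₊ * 2 := by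
          rw [show (1 / 4 : ℝ) = 1 / 2 * (1 / 2) by norm_num, mul_pow, _root_.one_div_pow]
          field_simp
      _ ≤ (1 / 2 : ℝ) ^ ⌈y⌉₊ * (2 ^ ⌈y⌉₊ * δ) := by gcongr
      _ = δ := by rw [_root_.one_div_pow]; field_simp
  -- Here `⌈y⌉ + 1 < y + 2 ≤ 3y` since `y ≥ 1`, and `3y ≤ 6 log (2/δ)`.
  · have := Nat.ceil_lt_add_one (a := y) (by linarith)
    linarith

end Main

end

/-! ### Error budget and query count. -/

theorem mainTheorem7 :
    ∃ C : ℝ, 0 < C ∧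
      ∀ (N : ℕ) (Reg : Type) [Fintype Reg] [DecidableEq Reg]
        (enc : BasisLabel N ↪ Reg) (r₀ : Reg) (ε δ : ℝ), 0 < ε → 0 < δ → δ < 1 →
      ∃ 𝒜 : QueryAlgorithm Reg,
        (𝒜.uses : ℝ) ≤ C * Real.log (2 / δ) / ε ∧
        ∀ (S : OscillatorSystem N) (x v : ℝ → Fin N → ℝ) (E : ℝ),
          S.IsTrajectory x v → E = S.totalEnergy (x 0) (v 0) → 0 < E →
        ∀ (t : ℝ), 0 ≤ t →
        ∀ (V : Finset (Spring N)) (R U : Matrix Reg Reg ℂ),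
          IsReflectionOracle enc V R →
          PreparesWithin U r₀ (embedState enc (S.encodedState E (x t) (v t))) (ε / 4) →
          1 - δ ≤ 𝒜.outputProb R U r₀
            {u : ℝ | |u - S.potentialEnergyOn V (x t) / E| ≤ ε} := by
  -- `144 = 3 · 2 · 4 · 6`: three calls per iterate, rounding up to a power of two, `K ≤ 4/ε`, and
  -- `L + 1 ≤ 6 log (2/δ)`.
  refine ⟨144, by norm_num, fun N Reg _ _ enc r₀ ε δ hε hδ hδ1 => ?_⟩
  have hlog : 0 < Real.log (2 / δ) := Real.log_pos (by rw [lt_div_iff₀ hδ]; linarith)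
  -- The ratio lies in `[0, 1]`, so for `ε ≥ 1/2` the guess `1/2` is always good enough. For small
  -- `ε`, rounding `K` up costs only a constant factor.
  rcases le_or_gt (1 / 2) ε with hε2 | hε2
  · refine ⟨constantAlgorithm Reg (1 / 2), ?_, ?_⟩
    · have : (constantAlgorithm Reg (1 / 2)).uses = 0 := rfl
      rw [this, Nat.cast_zero]
      positivity
    · intro S x v E hx hE hE0 t ht V R U _ _
      have hE' : S.totalEnergy (x t) (v t) = E := by rw [hE, hx.totalEnergy_eq ht]
      have h0 : 0 ≤ S.potentialEnergyOn V (x t) / E :=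
        div_nonneg (S.potentialEnergyOn_nonneg V _) hE0.le
      have h1 : S.potentialEnergyOn V (x t) / E ≤ 1 :=
        (div_le_one hE0).2 (hE' ▸ S.potentialEnergyOn_le_totalEnergy V (x t) (v t))
      rw [outputProb_constantAlgorithm]
      · linarith
      · rw [Set.mem_ofPred_eq, abs_le]
        constructor <;> linarith
  · obtain ⟨L, hLδ, hL⟩ := exists_window_exponent hδ hδ1
    -- Of the error `ε`, the inexact preparation uses `ε/4`: distance `ε/4`, doubled in the
    -- expectation and halved in `(1 - ⟨R⟩)/2`. The remaining `3ε/4 = η/2` goes to phase estimation,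
    -- so `η = 3ε/2`, and `K η ≥ 4` reads `K ≥ 8/(3ε)`.
    set K := ⌈8 / (3 * ε)⌉₊
    have hKlow : 8 / (3 * ε) ≤ K := Nat.le_ceil _
    have hK0 : (0 : ℝ) < K := lt_of_lt_of_le (by positivity) hKlow
    have hK : K ≠ 0 := Nat.cast_ne_zero.1 hK0.ne'
    have hKhigh : K ≤ 4 / ε := by
      refine (Nat.ceil_lt_add_one (by positivity)).le.trans ?_
      rw [div_add_one (by positivity), div_le_div_iff₀ (by positivity) hε]
      nlinarith
    -- The lower bound makes the window fit into the counter; the upper bound gives `2 ^ a / K ≤ 2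
    -- (L + 1)`, the factor that `exists_window_exponent` absorbs.
    obtain ⟨a, ha1, ha2⟩ := exists_two_pow_near (Nat.mul_ne_zero hK (Nat.succ_ne_zero L))
    have ha2' : (2 : ℝ) ^ a ≤ 2 * (K * (L + 1)) := by exact_mod_cast ha2
    obtain ⟨W, hWu, hW⟩ := exists_unitary_mulVec_ket
      (sum_norm_sq_window hK (Nat.succ_ne_zero L) ha1) fun _ => false
    refine ⟨phaseEstimation r₀ a ⟨W, hWu⟩, ?_, ?_⟩
    · have h : ((phaseEstimation r₀ a ⟨W, hWu⟩).uses : ℝ) ≤ 3 * 2 ^ a := by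
        exact_mod_cast uses_phaseEstimation_le r₀ ⟨W, hWu⟩
      calc _ ≤ 3 * (2 * (K * (L + 1 : ℝ))) := h.trans (by linarith)
        _ ≤ 3 * (2 * (4 / ε * (6 * Real.log (2 / δ)))) := by gcongr
        _ = _ := by ring
    · intro S x v E hx hE hE0 t ht V R U hR hU
      have hE' : S.totalEnergy (x t) (v t) = E := by rw [hE, hx.totalEnergy_eq ht]
      have hψ : ∑ r, ‖embedState enc (S.encodedState E (x t) (v t)) r‖ ^ 2 = 1 := by
        rw [sum_norm_sq_embedState, OscillatorSystem.sum_norm_sq_encodedState hE0 hE']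
      have hφ : ∑ r, ‖(U *ᵥ ket r₀) r‖ ^ 2 = 1 := by
        rw [sum_norm_sq_mulVec hU.1, sum_norm_sq_ket]
      have hclose := (abs_expectation_sub_le hR.unitary hφ hψ).trans
        (mul_le_mul_of_nonneg_left hU.2 zero_le_two)
      rw [hR.expectation_embedState, OscillatorSystem.sum_norm_sq_encodedState hE0 hE',
        OscillatorSystem.sum_norm_sq_encodedState_inr hE0] at hclose
      refine le_trans ?_ (le_outputProb_phaseEstimation hK ha1 (η := 3 * ε / 2) (by positivity) ?_
        hR.hermitian hR.unitary hU.1 r₀ ⟨W, hWu⟩ hW ?_)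
      · have h : (1 / 4 : ℝ) ^ L * (2 ^ a / K) ≤ (1 / 4) ^ L * (2 * (L + 1)) := by
          gcongr
          rw [div_le_iff₀ hK0]
          linarith
        linarith
      · rw [div_le_iff₀ (by positivity)] at hKlow
        linarith
      · intro u hu
        rw [Set.mem_ofPred_eq]
        rw [abs_le] at hu hclose ⊢
        constructor <;> linarith [hu.1, hu.2, hclose.1, hclose.2]
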